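/- Let $n\ge 2$ and let $S\subset[0,\pi]$ be a countable set. Then there is a compact set $E\subset\mathbb{R}^n$ of Hausdorff dimension exactly $n/8$ such that (i) for all pairwise distinct points $x,y,z\in E$, the angle $\angle xyz\in[0,\pi]$ (at the vertex $y$) does not belong to $S$; and (ii) for all pairwise distinct points $x,y,z,v\in E$, the angle $\arccos\dfrac{\langle x-y,\,z-v\rangle}{|x-y|\,|z-v|}\in[0,\pi]$ between $x-y$ and $z-v$ does not belong to $S$. -/

import Mathlib

open scoped ENNReal

open MeasureTheory Filter Topology

/-! Points with angle `θ` between `x - y` and `z - v` are zeros of a polynomial, quadratic in each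
difference, with coefficient `cos² θ` (`angleForm`). On quadruples from `(1 / N) ℤⁿ` its values are
almost multiples of some `g`: by Dirichlet, `cos² θ ≈ j / k` with `k ≲ N ^ 4`, and `g = 1 / (N ^ 4
k) ≳ N ^ (-8)` (`nearlyDiscrete_angleForm`). If the points near `x` are moved along an axis by a
small multiple of `g`, and the derivative there is nonzero, the value changes by an amount
comparable to `g` but at most `g / 2`. It thus leaves the multiples of `g`, in particular `0`, and
errors `κ / N ^ 8` in the points do no harm (`NearlyDiscrete.exists_shift_ne_zero`).

A Cantor set that at sparse scales `1 / N` is squeezed into cubes of side about `N ^ (-8)` at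
roughly `N ^ n` (shifted) lattice points has dimension `n / 8` (`CantorScheme.dimH_limitSet`).
Countability of `S` lets every choice of form, axis, rate and ball be served at infinitely many
stages (`exists_isCompact_dimH_eq_forall_ne_zero`).

The derivative condition fails if `cos² θ` is `0` or `1`, as `angleForm` then has vanishing gradient
at its zeros. Orthogonal and parallel differences are therefore excluded through `dotForm` and
`minorForm`, whether or not these angles lie in `S`. Angles at a vertex are the case `v = y`. -/

/-- Parameters of a Cantor-type construction in `ℝⁿ`: at stage `k` each surviving cube, of side
`side k`, is replaced by `branch k ^ n` cubes of side `side (k + 1)`, whose corners are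
consecutive points of the lattice `(1 / mesh k) ℤⁿ` translated by a vector `shift k q` depending
on the corner `q` of the parent cube. -/
structure CantorScheme (n : ℕ) where
  mesh : ℕ → ℕ
  branch : ℕ → ℕ
  side : ℕ → ℝ
  shift : ℕ → (Fin n → ℝ) → (Fin n → ℝ)
  side_zero : side 0 = 1
  side_pos : ∀ k, 0 < side k
  two_le_mesh : ∀ k, 2 ≤ mesh k
  shift_nonneg : ∀ k q i, 0 ≤ shift k q i
  shift_le : ∀ k q i, shift k q i ≤ 1 / mesh k
  side_succ_le : ∀ k, side (k + 1) ≤ 1 / (mesh k : ℝ) ^ 8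
  two_le_branch : ∀ k, 2 ≤ branch k
  branch_add_two_le : ∀ k, (branch k : ℝ) + 2 ≤ mesh k * side k
  mesh_mul_side_le : ∀ k, mesh k * side k ≤ 2 * branch k
  growth : ∀ k, 1 ≤ branch k * side (k + 1) ^ ((1 / 8 : ℝ) * (1 - 1 / (k + 1)))

/-! ### Cantor schemes: nesting, compactness, upper bound for the dimension -/

namespace CantorScheme

variable {n : ℕ} (S : CantorScheme n)

/-- The corner of the child cube with digit vector `d` of the cube of stage `k` with corner `q`. -/
noncomputable def child (k : ℕ) (q : Fin n → ℝ) (d : Fin n → ℕ) : Fin n → ℝ :=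
  fun i => ((⌊S.mesh k * q i⌋ : ℝ) + 1 + d i) / S.mesh k + S.shift k q i

open Classical in
/-- The corners of the cubes of stage `k`. -/
noncomputable def corners : ℕ → Finset (Fin n → ℝ)
  | 0 => {0}
  | k + 1 => (corners k ×ˢ Fintype.piFinset fun _ => Finset.range (S.branch k)).image
      fun z => S.child k z.1 z.2

/-- The cube of stage `k` with corner `q`. -/
def cube (k : ℕ) (q : Fin n → ℝ) : Set (Fin n → ℝ) := Set.Icc q (fun i => q i + S.side k)

/-- The limit set of the construction. -/
def limitSet : Set (Fin n → ℝ) := ⋂ k, ⋃ q ∈ S.corners k, S.cube k q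

/-- The number of cubes per coordinate axis at stage `k`. -/
def total (k : ℕ) : ℕ := ∏ j ∈ Finset.range k, S.branch j

lemma mesh_pos (k : ℕ) : (0 : ℝ) < S.mesh k := by
  have := S.two_le_mesh k
  exact_mod_cast (by omega : 0 < S.mesh k)

lemma branch_pos (k : ℕ) : 0 < S.branch k := two_pos.trans_le (S.two_le_branch k)

lemma total_succ (k : ℕ) : S.total (k + 1) = S.total k * S.branch k :=
  Finset.prod_range_succ _ _

lemma total_pos (k : ℕ) : 0 < S.total k := Finset.prod_pos fun j _ => S.branch_pos j

lemma side_succ_le_half_inv (k : ℕ) : S.side (k + 1) ≤ 1 / (2 * S.mesh k) := by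
  refine (S.side_succ_le k).trans ?_
  have h2 : (2 : ℝ) ≤ S.mesh k := by exact_mod_cast S.two_le_mesh k
  apply one_div_le_one_div_of_le (by linarith)
  calc (2 : ℝ) * S.mesh k ≤ S.mesh k ^ 1 * S.mesh k := by rw [pow_one]; gcongr
    _ = (S.mesh k : ℝ) ^ 2 := by ring
    _ ≤ (S.mesh k : ℝ) ^ 8 := pow_le_pow_right₀ (by linarith) (by norm_num)

/-- Before the shift a child corner is at most `branch k` mesh steps beyond `q`; the two spare steps
in `branch_add_two_le` absorb the shift and the side of the child. -/
lemma cube_child_subset (k : ℕ) (q : Fin n → ℝ) {d : Fin n → ℕ} (hd : ∀ i, d i < S.branch k) :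
    S.cube (k + 1) (S.child k q d) ⊆ S.cube k q := by
  have hN := S.mesh_pos k
  have h1 := S.side_succ_le_half_inv k
  have h2 : 1 / (2 * (S.mesh k : ℝ)) ≤ 1 / S.mesh k :=
    one_div_le_one_div_of_le hN (by linarith)
  intro x hx
  refine ⟨fun i => (?_ : q i ≤ x i), fun i => (?_ : x i ≤ q i + S.side k)⟩
  · have hx1 : S.child k q d i ≤ x i := hx.1 i
    have := Int.lt_floor_add_one (S.mesh k * q i)
    have hq : q i ≤ ((⌊S.mesh k * q i⌋ : ℝ) + 1 + d i) / S.mesh k := by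
      rw [le_div_iff₀ hN]
      have : (0 : ℝ) ≤ d i := by positivity
      linarith
    have := S.shift_nonneg k q i
    unfold child at hx1
    linarith
  · have hx2 : x i ≤ S.child k q d i + S.side (k + 1) := hx.2 i
    have hfl := Int.floor_le (S.mesh k * q i)
    have hdi : (d i : ℝ) + 1 ≤ S.branch k := by exact_mod_cast hd i
    have hb := S.branch_add_two_le k
    have hq : ((⌊S.mesh k * q i⌋ : ℝ) + 1 + d i) / S.mesh k + 1 / S.mesh k + 1 / S.mesh k
        ≤ q i + S.side k := by
      rw [← add_div, ← add_div, div_le_iff₀ hN]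
      linarith
    have := S.shift_le k q i
    unfold child at hx2
    linarith

lemma mem_corners_succ {k : ℕ} {q : Fin n → ℝ} : q ∈ S.corners (k + 1) ↔
    ∃ p ∈ S.corners k, ∃ d : Fin n → ℕ, (∀ i, d i < S.branch k) ∧ S.child k p d = q := by
  simp [corners, and_assoc]

lemma card_corners_le (k : ℕ) : (S.corners k).card ≤ S.total k ^ n := by
  induction k with
  | zero => simp [corners, total]
  | succ k ih =>
    rw [total_succ, mul_pow, corners]
    refine Finset.card_image_le.trans ?_
    rw [Finset.card_product, Fintype.card_piFinset_const, Finset.card_range]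
    gcongr

lemma isCompact_limitSet : IsCompact S.limitSet := by
  have hC : ∀ k, IsCompact (⋃ q ∈ S.corners k, S.cube k q) := fun k =>
    (S.corners k).isCompact_biUnion fun q _ => isCompact_Icc
  exact (hC 0).of_isClosed_subset (isClosed_iInter fun k => (hC k).isClosed)
    (Set.iInter_subset _ 0)

lemma limitSet_subset : S.limitSet ⊆ Set.Icc 0 1 := by
  intro x hx
  have h := Set.mem_iInter.1 hx 0
  simp only [corners, Finset.mem_singleton, Set.iUnion_iUnion_eq_left, cube, S.side_zero,
    Pi.zero_apply, zero_add] at h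
  exact h

lemma exists_child_of_mem {x : Fin n → ℝ} (hx : x ∈ S.limitSet) (k : ℕ) :
    ∃ q, ∃ d : Fin n → ℕ, x ∈ S.cube k q ∧ x ∈ S.cube (k + 1) (S.child k q d) := by
  have h := Set.mem_iInter.1 hx (k + 1)
  simp only [Set.mem_iUnion, exists_prop] at h
  obtain ⟨p, hp, hxp⟩ := h
  obtain ⟨q, -, d, hd, rfl⟩ := S.mem_corners_succ.1 hp
  exact ⟨q, d, S.cube_child_subset k q hd hxp, hxp⟩

lemma side_le_one (k : ℕ) : S.side k ≤ 1 := by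
  cases k with
  | zero => exact S.side_zero.le
  | succ k =>
    refine (S.side_succ_le k).trans ?_
    have h2 : (2 : ℝ) ≤ S.mesh k := by exact_mod_cast S.two_le_mesh k
    rw [div_le_one (by positivity)]
    exact one_le_pow₀ (by linarith)

lemma total_mul_side_le (k : ℕ) : S.total k * S.side k ≤ 1 := by
  induction k with
  | zero => simp [total, S.side_zero]
  | succ k ih =>
    have hN := S.mesh_pos k
    have h2 : (1 : ℝ) ≤ S.mesh k := by exact_mod_cast (by have := S.two_le_mesh k; omega)
    have hb : (S.branch k : ℝ) ≤ S.mesh k * S.side k := by linarith [S.branch_add_two_le k]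
    have h3 : S.side (k + 1) ≤ 1 / S.mesh k := (S.side_succ_le k).trans
      (one_div_le_one_div_of_le hN (le_self_pow₀ h2 (by norm_num)))
    rw [total_succ]
    push_cast
    calc (S.total k : ℝ) * S.branch k * S.side (k + 1)
        ≤ S.total k * (S.mesh k * S.side k) * (1 / S.mesh k) := by
          have := S.side_pos k
          have := S.side_pos (k + 1)
          gcongr
      _ = S.total k * S.side k := by field_simp
      _ ≤ 1 := ih

/-- Along each axis the cubes of stage `k` have total length at most `1`, and a length `ℓ` carries
at most `mesh k * ℓ` children. -/
lemma total_succ_le_mesh (k : ℕ) : (S.total (k + 1) : ℝ) ≤ S.mesh k := by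
  have hb : (S.branch k : ℝ) ≤ S.mesh k * S.side k := by linarith [S.branch_add_two_le k]
  rw [total_succ]
  push_cast
  calc (S.total k : ℝ) * S.branch k ≤ S.total k * (S.mesh k * S.side k) := by gcongr
    _ = S.mesh k * (S.total k * S.side k) := by ring
    _ ≤ S.mesh k * 1 := by gcongr; exact S.total_mul_side_le k
    _ = S.mesh k := mul_one _

lemma side_succ_le_half (k : ℕ) : S.side (k + 1) ≤ S.side k / 2 := by
  have hN := S.mesh_pos k
  refine (S.side_succ_le_half_inv k).trans ?_
  rw [div_le_iff₀ (by positivity)]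
  have : (0 : ℝ) < S.branch k := by exact_mod_cast S.branch_pos k
  linarith [S.branch_add_two_le k]

lemma side_le_half_pow (k : ℕ) : S.side k ≤ (1 / 2) ^ k := by
  induction k with
  | zero => simp [S.side_zero]
  | succ k ih => rw [pow_succ]; linarith [S.side_succ_le_half k]

lemma tendsto_side : Tendsto S.side atTop (𝓝 0) :=
  squeeze_zero (fun k => (S.side_pos k).le) S.side_le_half_pow
    (tendsto_pow_atTop_nhds_zero_of_lt_one (by norm_num) (by norm_num))

lemma ediam_cube_le (k : ℕ) (q : Fin n → ℝ) :
    Metric.ediam (S.cube k q) ≤ ENNReal.ofReal (S.side k) := by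
  unfold cube
  rw [← Set.pi_univ_Icc]
  refine Metric.ediam_pi_le_of_le fun i => ?_
  rw [Real.ediam_Icc, add_sub_cancel_left]

/-- Stage `k + 1` covers by at most `mesh k ^ n` cubes of side at most `mesh k ^ (-8)`, so the sum
of the powers `n / 8` of the diameters is at most `1`. -/
lemma hausdorffMeasure_limitSet_le : μH[(n / 8 : ℝ)] S.limitSet ≤ 1 := by
  have hn : (0 : ℝ) ≤ n / 8 := by positivity
  refine (Measure.hausdorffMeasure_le_liminf_sum (ι := fun k => S.corners (k + 1)) (l := atTop)
    (n / 8 : ℝ) S.limitSet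
    (fun k => ENNReal.ofReal (S.side (k + 1))) ?_ (fun k q => S.cube (k + 1) q) ?_ ?_).trans ?_
  · have := ENNReal.tendsto_ofReal (S.tendsto_side.comp (tendsto_add_atTop_nat 1))
    simpa using this
  · exact Eventually.of_forall fun k q => S.ediam_cube_le _ _
  · refine Eventually.of_forall fun k x hx => ?_
    have h := Set.mem_iInter.1 hx (k + 1)
    simpa using h
  · refine liminf_le_of_frequently_le' (Frequently.of_forall fun k => ?_)
    have hN := S.mesh_pos k
    have hs := S.side_pos (k + 1)
    calc ∑ q : S.corners (k + 1), Metric.ediam (S.cube (k + 1) q) ^ (n / 8 : ℝ)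
        ≤ ∑ q : S.corners (k + 1), ENNReal.ofReal (S.side (k + 1) ^ (n / 8 : ℝ)) := by
          refine Finset.sum_le_sum fun q _ => ?_
          rw [← ENNReal.ofReal_rpow_of_pos hs]
          exact ENNReal.rpow_le_rpow (S.ediam_cube_le _ _) hn
      _ = ENNReal.ofReal ((S.corners (k + 1)).card * S.side (k + 1) ^ (n / 8 : ℝ)) := by
          rw [Finset.sum_const, Finset.card_univ, Fintype.card_coe, nsmul_eq_mul,
            ENNReal.ofReal_mul (by positivity), ENNReal.ofReal_natCast]
      _ ≤ ENNReal.ofReal 1 := by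
          apply ENNReal.ofReal_le_ofReal
          have h1 : ((S.corners (k + 1)).card : ℝ) ≤ (S.mesh k : ℝ) ^ n := by
            calc ((S.corners (k + 1)).card : ℝ) ≤ (S.total (k + 1) : ℝ) ^ n := by
                  exact_mod_cast S.card_corners_le (k + 1)
              _ ≤ _ := pow_le_pow_left₀ (by positivity) (S.total_succ_le_mesh k) n
          have h2 : S.side (k + 1) ^ (n / 8 : ℝ) ≤ 1 / (S.mesh k : ℝ) ^ n := by
            calc S.side (k + 1) ^ (n / 8 : ℝ) ≤ (1 / (S.mesh k : ℝ) ^ 8) ^ (n / 8 : ℝ) :=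
                  Real.rpow_le_rpow hs.le (S.side_succ_le k) hn
              _ = 1 / (S.mesh k : ℝ) ^ n := by
                  rw [Real.div_rpow zero_le_one (by positivity), Real.one_rpow,
                    ← Real.rpow_natCast _ 8, ← Real.rpow_mul hN.le, ← Real.rpow_natCast _ n]
                  congr 2
                  push_cast
                  ring
          calc _ ≤ (S.mesh k : ℝ) ^ n * (1 / (S.mesh k : ℝ) ^ n) := by
                gcongr
            _ = 1 := by field_simp
      _ = 1 := ENNReal.ofReal_one

lemma dimH_limitSet_le : dimH S.limitSet ≤ (n : ℝ≥0∞) / 8 := by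
  have h := dimH_le_of_hausdorffMeasure_ne_top (s := S.limitSet) (d := (n / 8 : NNReal)) (by
    have := S.hausdorffMeasure_limitSet_le
    push_cast
    exact (this.trans_lt ENNReal.one_lt_top).ne)
  refine h.trans_eq ?_
  rw [ENNReal.coe_div (by norm_num)]
  simp

end CantorScheme

/-! ### Lower bound for the dimension: mixed radix digits and a Hölder inverse -/

namespace CantorScheme

variable {n : ℕ} (S : CantorScheme n)

/-- The digit vector of order `k` of `u` in the mixed radix expansion with bases `branch`. -/
noncomputable def digit (u : Fin n → ℝ) (k : ℕ) : Fin n → ℕ :=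
  fun i => ⌊u i * S.total (k + 1)⌋₊ % S.branch k

/-- The corners of the cubes selected by the digits of `u`. -/
noncomputable def path (u : Fin n → ℝ) : ℕ → (Fin n → ℝ)
  | 0 => 0
  | k + 1 => S.child k (path u k) (S.digit u k)

/-- The point of the limit set with the same digits as `u`. -/
noncomputable def point (u : Fin n → ℝ) : Fin n → ℝ := ⨆ k, S.path u k

lemma digit_lt (u : Fin n → ℝ) (k : ℕ) (i : Fin n) : S.digit u k i < S.branch k :=
  Nat.mod_lt _ (S.branch_pos k)

lemma path_mem_corners (u : Fin n → ℝ) (k : ℕ) : S.path u k ∈ S.corners k := by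
  induction k with
  | zero => simp [path, corners]
  | succ k ih => exact S.mem_corners_succ.2 ⟨_, ih, _, S.digit_lt u k, rfl⟩

lemma point_mem_cube (u : Fin n → ℝ) (k : ℕ) : S.point u ∈ S.cube k (S.path u k) := by
  have h := ciSup_mem_iInter_Icc_of_antitone_Icc (f := S.path u)
    (g := fun k i => S.path u k i + S.side k)
    (antitone_nat_of_succ_le fun k => S.cube_child_subset k _ (S.digit_lt u k))
    (fun k i => le_add_of_nonneg_right (S.side_pos k).le)
  exact Set.mem_iInter.1 h k

lemma point_mem_limitSet (u : Fin n → ℝ) : S.point u ∈ S.limitSet :=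
  Set.mem_iInter.2 fun k => Set.mem_biUnion (S.path_mem_corners u k) (S.point_mem_cube u k)

lemma path_congr {u v : Fin n → ℝ} {k : ℕ} (h : ∀ j < k, S.digit u j = S.digit v j) :
    S.path u k = S.path v k := by
  induction k with
  | zero => rfl
  | succ k ih => rw [path, path, ih fun j hj => h j (by omega), h k (by omega)]

lemma floor_mul_total_succ (u : ℝ) (k : ℕ) :
    ⌊u * S.total (k + 1)⌋₊ / S.branch k = ⌊u * S.total k⌋₊ := by
  have hb : (S.branch k : ℝ) ≠ 0 := by exact_mod_cast (S.branch_pos k).ne'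
  rw [← Nat.floor_div_natCast, total_succ]
  congr 1
  push_cast
  field_simp

lemma floor_mul_total_congr {u v : Fin n → ℝ} (hu : ∀ i, u i ∈ Set.Ico (0 : ℝ) 1)
    (hv : ∀ i, v i ∈ Set.Ico (0 : ℝ) 1) {k : ℕ} (h : ∀ j < k, S.digit u j = S.digit v j)
    (i : Fin n) : ⌊u i * S.total k⌋₊ = ⌊v i * S.total k⌋₊ := by
  induction k with
  | zero =>
    have h0 : ∀ t ∈ Set.Ico (0 : ℝ) 1, ⌊t * (S.total 0 : ℝ)⌋₊ = 0 := fun t ht => by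
      rw [Nat.floor_eq_zero]; simpa [total] using ht.2
    rw [h0 _ (hu i), h0 _ (hv i)]
  | succ k ih =>
    rw [← Nat.div_add_mod ⌊u i * S.total (k + 1)⌋₊ (S.branch k),
      ← Nat.div_add_mod ⌊v i * S.total (k + 1)⌋₊ (S.branch k), floor_mul_total_succ,
      floor_mul_total_succ, ih fun j hj => h j (by omega)]
    congr 1
    exact congrFun (h k (by omega)) i

lemma two_pow_le_total (k : ℕ) : 2 ^ k ≤ S.total k := by
  induction k with
  | zero => simp [total]
  | succ k ih => rw [total_succ, pow_succ]; gcongr; exact S.two_le_branch k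

/-- If the digits of `u` and `v` agree up to order `k`, then `u` and `v` are close. -/
lemma abs_sub_le_of_digit_eq {u v : Fin n → ℝ} (hu : ∀ i, u i ∈ Set.Ico (0 : ℝ) 1)
    (hv : ∀ i, v i ∈ Set.Ico (0 : ℝ) 1) {k : ℕ} (h : ∀ j < k, S.digit u j = S.digit v j)
    (i : Fin n) :
    |u i - v i| ≤ (|(S.digit u k i : ℝ) - S.digit v k i| + 1) / S.total (k + 1) := by
  have hT : (0 : ℝ) < S.total (k + 1) := by exact_mod_cast S.total_pos _
  have e : ∀ w : Fin n → ℝ, ((S.digit w k i : ℕ) : ℝ)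
      = ⌊w i * S.total (k + 1)⌋₊ - S.branch k * (⌊w i * S.total k⌋₊ : ℝ) := by
    intro w
    rw [eq_sub_iff_add_eq, ← S.floor_mul_total_succ]
    exact_mod_cast Nat.mod_add_div _ _
  have e2 : (S.digit u k i : ℝ) - S.digit v k i
      = ⌊u i * S.total (k + 1)⌋₊ - ⌊v i * S.total (k + 1)⌋₊ := by
    rw [e, e, S.floor_mul_total_congr hu hv h i]; ring
  have u1 := Nat.floor_le (mul_nonneg (hu i).1 hT.le)
  have u2 := Nat.lt_floor_add_one (u i * S.total (k + 1))
  have v1 := Nat.floor_le (mul_nonneg (hv i).1 hT.le)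
  have v2 := Nat.lt_floor_add_one (v i * S.total (k + 1))
  rw [le_div_iff₀ hT, e2, ← abs_of_pos hT, ← abs_mul, abs_of_pos hT, abs_le]
  have a1 := neg_abs_le ((⌊u i * S.total (k + 1)⌋₊ : ℝ) - ⌊v i * S.total (k + 1)⌋₊)
  have a2 := le_abs_self ((⌊u i * S.total (k + 1)⌋₊ : ℝ) - ⌊v i * S.total (k + 1)⌋₊)
  constructor <;> linarith

lemma exists_digit_ne {u v : Fin n → ℝ} (hu : ∀ i, u i ∈ Set.Ico (0 : ℝ) 1)
    (hv : ∀ i, v i ∈ Set.Ico (0 : ℝ) 1) (h : u ≠ v) : ∃ k, S.digit u k ≠ S.digit v k := by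
  by_contra! H
  refine h (funext fun i => ?_)
  have hle : ∀ k : ℕ, |u i - v i| ≤ (1 / 2) ^ k := fun k => by
    have h1 := S.abs_sub_le_of_digit_eq hu hv (k := k) (fun j _ => H j) i
    rw [H k, sub_self, abs_zero, zero_add] at h1
    refine h1.trans ?_
    rw [one_div_pow]
    apply one_div_le_one_div_of_le (by positivity)
    have h2 := (pow_le_pow_right₀ (one_le_two) (Nat.le_succ k)).trans (S.two_pow_le_total (k + 1))
    exact_mod_cast h2
  have := ge_of_tendsto' (tendsto_pow_atTop_nhds_zero_of_lt_one (r := (1 / 2 : ℝ))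
    (by norm_num) (by norm_num)) hle
  exact sub_eq_zero.1 (abs_nonpos_iff.1 this)

/-- Distinct digits at the first place of disagreement separate the points. -/
lemma abs_digit_sub_le {u v : Fin n → ℝ} {k : ℕ} (h : ∀ j < k, S.digit u j = S.digit v j)
    (i : Fin n) : |(S.digit u k i : ℝ) - S.digit v k i|
      ≤ 2 * S.mesh k * dist (S.point u) (S.point v) := by
  have hN := S.mesh_pos k
  rcases eq_or_ne (S.digit u k i) (S.digit v k i) with he | he
  · rw [he, sub_self, abs_zero]; positivity
  have hone : (1 : ℝ) ≤ |(S.digit u k i : ℝ) - S.digit v k i| := by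
    have : (1 : ℤ) ≤ |(S.digit u k i : ℤ) - S.digit v k i| :=
      Int.one_le_abs (sub_ne_zero.2 (by exact_mod_cast he))
    exact_mod_cast this
  have hu := S.point_mem_cube u (k + 1)
  have hv := S.point_mem_cube v (k + 1)
  have hu1 : S.path u (k + 1) i ≤ S.point u i := hu.1 i
  have hu2 : S.point u i ≤ S.path u (k + 1) i + S.side (k + 1) := hu.2 i
  have hv1 : S.path v (k + 1) i ≤ S.point v i := hv.1 i
  have hv2 : S.point v i ≤ S.path v (k + 1) i + S.side (k + 1) := hv.2 i
  have hd : |S.point u i - S.point v i| ≤ dist (S.point u) (S.point v) := by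
    rw [← Real.dist_eq]; exact dist_le_pi_dist _ _ i
  -- The shift depends only on the parent corner, which is common to both paths, so it cancels.
  have hpath : S.path u (k + 1) i - S.path v (k + 1) i
      = ((S.digit u k i : ℝ) - S.digit v k i) / S.mesh k := by
    rw [path, path, child, child, S.path_congr h]
    ring
  have hs := S.side_succ_le_half_inv k
  have key : |(S.digit u k i : ℝ) - S.digit v k i| / S.mesh k
      ≤ dist (S.point u) (S.point v) + 1 / (2 * S.mesh k) := by
    rw [← abs_of_pos hN, ← abs_div, abs_of_pos hN, ← hpath]
    obtain ⟨d1, d2⟩ := abs_le.1 hd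
    rw [abs_le]
    constructor <;> linarith
  have e1 : 1 / (2 * (S.mesh k : ℝ)) = 1 / 2 / S.mesh k := by field_simp
  rw [e1, ← sub_le_iff_le_add, ← sub_div, div_le_iff₀ hN] at key
  linarith

/-- The exponents in `growth` tend to `1 / 8`, hence eventually exceed `s`; the remaining finitely
many stages only affect the constant. -/
lemma exists_le_total_mul_side_rpow {s : ℝ} (hs : s < 1 / 8) :
    ∃ c > 0, ∀ k, c ≤ S.total k * S.side k ^ s := by
  have hpos : ∀ k, 0 < S.total k * S.side k ^ s := fun k =>
    mul_pos (by exact_mod_cast S.total_pos k) (Real.rpow_pos_of_pos (S.side_pos k) s)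
  have hlim : Tendsto (fun k : ℕ => (1 / 8 : ℝ) * (1 - 1 / ((k : ℝ) + 1))) atTop
      (𝓝 (1 / 8 * (1 - 0))) :=
    (tendsto_const_nhds.sub tendsto_one_div_add_atTop_nhds_zero_nat).const_mul _
  rw [sub_zero, mul_one] at hlim
  obtain ⟨K, hK⟩ := eventually_atTop.1 (hlim.eventually (lt_mem_nhds hs))
  have hfin : ∀ m : ℕ, ∃ c > 0, ∀ k < m, c ≤ S.total k * S.side k ^ s := by
    intro m
    induction m with
    | zero => exact ⟨1, one_pos, by simp⟩
    | succ m ih =>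
      obtain ⟨c, hc, h⟩ := ih
      refine ⟨min c (S.total m * S.side m ^ s), lt_min hc (hpos m), fun k hk => ?_⟩
      rcases Nat.lt_succ_iff_lt_or_eq.1 hk with hk | rfl
      · exact (min_le_left _ _).trans (h k hk)
      · exact min_le_right _ _
  obtain ⟨c, hc, h⟩ := hfin (K + 1)
  refine ⟨min c 1, lt_min hc one_pos, fun k => ?_⟩
  rcases lt_or_ge k (K + 1) with hk | hk
  · exact (min_le_left _ _).trans (h k hk)
  obtain ⟨k, rfl⟩ : ∃ m, k = m + 1 := ⟨k - 1, by omega⟩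
  refine (min_le_right _ _).trans ((S.growth k).trans ?_)
  have h1 : (S.branch k : ℝ) ≤ S.total (k + 1) := by
    rw [total_succ]
    exact_mod_cast Nat.le_mul_of_pos_left _ (S.total_pos k)
  exact mul_le_mul h1
    (Real.rpow_le_rpow_of_exponent_ge (S.side_pos _) (S.side_le_one _) (hK k (by omega)).le)
    (Real.rpow_nonneg (S.side_pos _).le _) (by positivity)

/-- At the first differing digit, of order `k`, the digit gap is at most both `2 * mesh k * D` and
`branch k`, where `D` is the distance of the image points. Divided by `branch k`, the smaller bound
is at most `1`, so raising it to the power `s` only enlarges it and yields `(4 * D / side k) ^ s`;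
the factor `total k * side k ^ s` is bounded below. -/
lemma exists_dist_le_dist_point_rpow {s : ℝ} (hs0 : 0 < s) (hs : s < 1 / 8) :
    ∃ C > 0, ∀ u v : Fin n → ℝ, (∀ i, u i ∈ Set.Ico (0 : ℝ) 1) → (∀ i, v i ∈ Set.Ico (0 : ℝ) 1) →
      dist u v ≤ C * dist (S.point u) (S.point v) ^ s := by
  classical
  obtain ⟨c, hc, hck⟩ := S.exists_le_total_mul_side_rpow hs
  refine ⟨2 * 4 ^ s / c, by positivity, fun u v hu hv => ?_⟩
  rcases eq_or_ne u v with rfl | hne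
  · rw [dist_self]; positivity
  have hex := S.exists_digit_ne hu hv hne
  set k := Nat.find hex with hk
  have hkne : S.digit u k ≠ S.digit v k := Nat.find_spec hex
  have hlt : ∀ j < k, S.digit u j = S.digit v j := fun j hj => not_not.1 (Nat.find_min hex hj)
  set D := dist (S.point u) (S.point v) with hD
  have hN := S.mesh_pos k
  have hδ := S.side_pos k
  have hB : (0 : ℝ) < S.branch k := by exact_mod_cast S.branch_pos k
  have hT : (0 : ℝ) < S.total k := by exact_mod_cast S.total_pos k
  have hdig : ∀ i, |(S.digit u k i : ℝ) - S.digit v k i| ≤ min (2 * S.mesh k * D) (S.branch k) := by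
    refine fun i => le_min (S.abs_digit_sub_le hlt i) ?_
    have h1 : (S.digit u k i : ℝ) < S.branch k := by exact_mod_cast S.digit_lt u k i
    have h2 : (S.digit v k i : ℝ) < S.branch k := by exact_mod_cast S.digit_lt v k i
    have h3 : (0 : ℝ) ≤ S.digit u k i := by positivity
    have h4 : (0 : ℝ) ≤ S.digit v k i := by positivity
    rw [abs_le]
    constructor <;> linarith
  set z := min (2 * S.mesh k * D) (S.branch k : ℝ) with hz
  -- This lets `z` absorb the `+ 1` in `abs_sub_le_of_digit_eq`.
  have hz1 : 1 ≤ z := by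
    obtain ⟨i, hi⟩ := Function.ne_iff.1 hkne
    refine le_trans ?_ (hdig i)
    have : (1 : ℤ) ≤ |(S.digit u k i : ℤ) - S.digit v k i| :=
      Int.one_le_abs (sub_ne_zero.2 (by exact_mod_cast hi))
    exact_mod_cast this
  have hzB : z / S.branch k ≤ (4 * D / S.side k) ^ s := by
    have h0 : 0 < z / S.branch k := by positivity
    calc z / S.branch k ≤ (z / S.branch k) ^ s := by
          have := Real.rpow_le_rpow_of_exponent_ge h0
            ((div_le_one hB).2 (min_le_right _ _)) (by linarith : s ≤ 1)
          rwa [Real.rpow_one] at this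
      _ ≤ (4 * D / S.side k) ^ s := by
          refine Real.rpow_le_rpow h0.le ?_ hs0.le
          have hD0 : 0 ≤ D := dist_nonneg
          rw [div_le_div_iff₀ hB hδ]
          calc z * S.side k ≤ 2 * S.mesh k * D * S.side k := by gcongr; exact min_le_left _ _
            _ = 2 * D * (S.mesh k * S.side k) := by ring
            _ ≤ 2 * D * (2 * S.branch k) := 
              mul_le_mul_of_nonneg_left (S.mesh_mul_side_le k) (by positivity)
            _ = 4 * D * S.branch k := by ring
  have hrhs : 0 ≤ 2 * 4 ^ s / c * D ^ s := by positivity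
  refine (dist_pi_le_iff hrhs).2 fun i => ?_
  rw [Real.dist_eq]
  have hD0 : 0 ≤ D := dist_nonneg
  calc |u i - v i| ≤ (|(S.digit u k i : ℝ) - S.digit v k i| + 1) / S.total (k + 1) :=
        S.abs_sub_le_of_digit_eq hu hv hlt i
    _ ≤ (z + z) / S.total (k + 1) := by gcongr; exact hdig i
    _ = 2 / S.total k * (z / S.branch k) := by rw [total_succ]; push_cast; field_simp; ring
    _ ≤ 2 / S.total k * (4 * D / S.side k) ^ s := by gcongr
    _ = 2 * 4 ^ s / (S.total k * S.side k ^ s) * D ^ s := by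
        rw [Real.div_rpow (by positivity) hδ.le, Real.mul_rpow (by norm_num) hD0]
        field_simp
    _ ≤ 2 * 4 ^ s / c * D ^ s := by gcongr; exact hck k

/-- The inverse of `point` is `s`-Hölder and maps a subset of the limit set onto `[0, 1)ⁿ`, which
has dimension `n`. -/
lemma mul_le_dimH_limitSet {s : NNReal} (hs0 : 0 < s) (hs : (s : ℝ) < 1 / 8) :
    (n : ℝ≥0∞) * s ≤ dimH S.limitSet := by
  obtain ⟨C, hC, h⟩ := S.exists_dist_le_dist_point_rpow (NNReal.coe_pos.2 hs0) hs
  set A : Set (Fin n → ℝ) := Set.univ.pi fun _ => Set.Ico (0 : ℝ) 1 with hA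
  have hinj : Set.InjOn S.point A := fun u hu v hv huv => by
    have := h u v (fun i => hu i trivial) (fun i => hv i trivial)
    rw [huv, dist_self, Real.zero_rpow (NNReal.coe_pos.2 hs0).ne', mul_zero] at this
    exact dist_le_zero.1 this
  have hinv : Set.LeftInvOn (Function.invFunOn S.point A) S.point A := hinj.leftInvOn_invFunOn
  have hold : HolderOnWith C.toNNReal s (Function.invFunOn S.point A) (S.point '' A) := by
    rintro _ ⟨u, hu, rfl⟩ _ ⟨v, hv, rfl⟩
    rw [hinv hu, hinv hv, edist_dist, edist_dist]
    rw [ENNReal.ofReal_rpow_of_nonneg dist_nonneg s.coe_nonneg,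
      ← ENNReal.ofReal, ← ENNReal.ofReal_mul hC.le]
    exact ENNReal.ofReal_le_ofReal (h u v (fun i => hu i trivial) fun i => hv i trivial)
  have hdim : dimH A = n := by
    have h1 : (interior A).Nonempty := by
      rw [hA, interior_pi_set Set.finite_univ]
      refine ⟨fun _ => 1 / 2, fun i _ => ?_⟩
      rw [interior_Ico]
      norm_num
    rw [Real.dimH_of_nonempty_interior h1, Module.finrank_fin_fun]
  have h2 := hold.dimH_image_le hs0
  rw [hinv.image_image, hdim] at h2
  have h3 : dimH (S.point '' A) ≤ dimH S.limitSet :=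
    dimH_mono (Set.image_subset_iff.2 fun u _ => S.point_mem_limitSet u)
  have h4 := h2.trans (ENNReal.div_le_div_right h3 _)
  rwa [ENNReal.le_div_iff_mul_le (Or.inl (by exact_mod_cast hs0.ne')) (Or.inl (by simp))] at h4

theorem dimH_limitSet : dimH S.limitSet = (n : ℝ≥0∞) / 8 := by
  refine le_antisymm S.dimH_limitSet_le (ENNReal.le_of_forall_nnreal_lt fun r hr => ?_)
  rcases eq_or_ne r 0 with rfl | hr0
  · simp
  have hr' : r < (n / 8 : NNReal) := by
    rw [← ENNReal.coe_lt_coe, ENNReal.coe_div (by norm_num)]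
    simpa using hr
  have hn : (0 : NNReal) < n := by
    rcases Nat.eq_zero_or_pos n with h | h
    · simp [h] at hr'
    · exact_mod_cast h
  have h := S.mul_le_dimH_limitSet (s := r / n) (by positivity) (by
    have : r / n < 1 / 8 := by
      rw [div_lt_iff₀ hn]
      calc r < n / 8 := hr'
        _ = 1 / 8 * n := by ring
    exact_mod_cast this)
  rwa [← ENNReal.coe_natCast, ← ENNReal.coe_mul, mul_div_cancel₀ _ hn.ne'] at h

end CantorScheme

/-! ### Schemes that follow prescribed shifts and tolerances -/

/-- A mesh fine enough to continue a Cantor scheme below cubes of side `δ`. -/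
lemma exists_mesh_branch {κ δ : ℝ} (hκ : 0 < κ) (hκ1 : κ ≤ 1) (hδ : 0 < δ) (k : ℕ) :
    ∃ N M : ℕ, 2 ≤ N ∧ k ≤ N ∧ 2 ≤ M ∧ (M : ℝ) + 2 ≤ N * δ ∧ N * δ ≤ 2 * M ∧
      1 ≤ M * (κ / (N : ℝ) ^ 8) ^ ((1 / 8 : ℝ) * (1 - 1 / (k + 1))) := by
  have e1 : (0 : ℝ) < 1 / (k + 1) := by positivity
  have h1 : Tendsto (fun N : ℕ => (N : ℝ) * δ) atTop atTop :=
    tendsto_natCast_atTop_atTop.atTop_mul_const hδ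
  have h2 : Tendsto (fun N : ℕ => (N : ℝ) ^ (1 / ((k : ℝ) + 1))) atTop atTop :=
    (tendsto_rpow_atTop e1).comp tendsto_natCast_atTop_atTop
  -- Since the exponent falls short of `1 / 8`, the growth quantity is at least `δ * κ / 2 * N ^ (1
  -- / (k + 1))`, which a large `N` brings above `1`. With `N * δ ≥ 6`, giving up two lattice points
  -- costs at most a factor `2`.
  obtain ⟨N, hN2, hNk, hNδ, hNg⟩ := ((eventually_ge_atTop 2).and ((eventually_ge_atTop k).and
    ((h1.eventually_ge_atTop 6).and (h2.eventually_ge_atTop (2 / (δ * κ)))))).exists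
  have hfl := Nat.floor_le (by positivity : 0 ≤ (N : ℝ) * δ)
  have hfl' := Nat.lt_floor_add_one ((N : ℝ) * δ)
  have h6 : 6 ≤ ⌊(N : ℝ) * δ⌋₊ := Nat.le_floor (by exact_mod_cast hNδ)
  have hM : ((⌊(N : ℝ) * δ⌋₊ - 2 : ℕ) : ℝ) = ⌊(N : ℝ) * δ⌋₊ - 2 := by
    rw [Nat.cast_sub (by omega)]; norm_num
  have hMN : N * δ ≤ 2 * ((⌊(N : ℝ) * δ⌋₊ - 2 : ℕ) : ℝ) := by rw [hM]; linarith
  refine ⟨N, ⌊(N : ℝ) * δ⌋₊ - 2, hN2, hNk, by omega, by rw [hM]; linarith, hMN, ?_⟩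
  have hN : (0 : ℝ) < N := by exact_mod_cast (by omega : 0 < N)
  set s : ℝ := (1 / 8 : ℝ) * (1 - 1 / (k + 1)) with hs
  have hs1 : s ≤ 1 := by rw [hs]; linarith
  have hpow : ((N : ℝ) ^ 8) ^ s * (N : ℝ) ^ (1 / ((k : ℝ) + 1)) = N := by
    rw [← Real.rpow_natCast _ 8, ← Real.rpow_mul hN.le, ← Real.rpow_add hN]
    conv_rhs => rw [← Real.rpow_one (N : ℝ)]
    congr 1
    rw [hs]
    push_cast
    ring
  have hP : 0 < ((N : ℝ) ^ 8) ^ s := by positivity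
  have hκs : κ ≤ κ ^ s := by
    simpa using Real.rpow_le_rpow_of_exponent_ge hκ hκ1 hs1
  rw [div_le_iff₀ (by positivity)] at hNg
  rw [Real.div_rpow hκ.le (by positivity), ← mul_div_assoc, le_div_iff₀ hP, one_mul]
  calc ((N : ℝ) ^ 8) ^ s ≤ ((N : ℝ) ^ 8) ^ s * ((N : ℝ) ^ (1 / ((k : ℝ) + 1)) * (δ * κ) / 2) :=
        le_mul_of_one_le_right hP.le (by linarith)
    _ = ((N : ℝ) ^ 8) ^ s * (N : ℝ) ^ (1 / ((k : ℝ) + 1)) * δ / 2 * κ := by ring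
    _ = N * δ / 2 * κ := by rw [hpow]
    _ ≤ ((⌊(N : ℝ) * δ⌋₊ - 2 : ℕ) : ℝ) * κ ^ s := by
        gcongr
        linarith

open Classical in
/-- There is a compact subset of the unit cube of dimension `n / 8` which, for each `t`, is at
infinitely many scales `1 / N` contained in the `κ t / N ^ 8`-neighbourhood of the lattice
`(1 / N) ℤⁿ`, shifted by `shift t N` on the part close to `U t`. -/
theorem exists_isCompact_near_lattice {n : ℕ} (κ : ℕ → ℝ) (hκ : ∀ t, 0 < κ t)
    (hκ1 : ∀ t, κ t ≤ 1) (shift : ℕ → ℕ → (Fin n → ℝ)) (hs0 : ∀ t N i, 0 ≤ shift t N i)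
    (hs1 : ∀ t N i, shift t N i ≤ 1 / N) (U : ℕ → Set (Fin n → ℝ)) :
    ∃ E : Set (Fin n → ℝ), IsCompact E ∧ dimH E = (n : ℝ≥0∞) / 8 ∧ E ⊆ Set.Icc 0 1 ∧
      ∀ t N₀ : ℕ, ∃ N ≥ N₀, 0 < N ∧ ∀ x ∈ E, ∃ q : Fin n → ℝ, ∃ p : Fin n → ℤ,
        dist x q ≤ 1 / (N₀ + 1) ∧
        dist x (fun i => (p i : ℝ) / N + if q ∈ U t then shift t N i else 0)
          ≤ κ t / (N : ℝ) ^ 8 := by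
  -- Positivity of `δ` is a premise inside the existential, so that the choice is defined for every
  -- real `δ` and the sides can be built by recursion before they are known to be positive.
  have hex : ∀ k : ℕ, ∀ δ : ℝ, ∃ N M : ℕ, 0 < δ → 2 ≤ N ∧ k ≤ N ∧ 2 ≤ M ∧
      (M : ℝ) + 2 ≤ N * δ ∧ N * δ ≤ 2 * M ∧
      1 ≤ M * (κ k.unpair.1 / (N : ℝ) ^ 8) ^ ((1 / 8 : ℝ) * (1 - 1 / (k + 1))) := fun k δ => by
    by_cases hδ : 0 < δ
    · obtain ⟨N, M, h⟩ := exists_mesh_branch (hκ k.unpair.1) (hκ1 k.unpair.1) hδ k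
      exact ⟨N, M, fun _ => h⟩
    · exact ⟨0, 0, fun h => absurd h hδ⟩
  choose N M hNM using hex
  let δ : ℕ → ℝ := fun k => Nat.rec 1 (fun k d => κ k.unpair.1 / (N k d : ℝ) ^ 8) k
  have hδs : ∀ k, δ (k + 1) = κ k.unpair.1 / (N k (δ k) : ℝ) ^ 8 := fun k => rfl
  have hδ : ∀ k, 0 < δ k := by
    intro k
    induction k with
    | zero => exact one_pos
    | succ k ih =>
      have := (hNM k _ ih).1
      have h2 : (0 : ℝ) < N k (δ k) := by exact_mod_cast (by omega : 0 < N k (δ k))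
      rw [hδs]
      have := hκ k.unpair.1
      positivity
  let S : CantorScheme n :=
    { mesh := fun k => N k (δ k)
      branch := fun k => M k (δ k)
      side := δ
      shift := fun k q => if q ∈ U k.unpair.1 then shift k.unpair.1 (N k (δ k)) else 0
      side_zero := rfl
      side_pos := hδ
      two_le_mesh := fun k => (hNM k _ (hδ k)).1
      shift_nonneg := fun k q i => by
        split_ifs
        · exact hs0 _ _ _
        · exact le_rfl
      shift_le := fun k q i => by
        split_ifs
        · exact hs1 _ _ _
        · rw [Pi.zero_apply]; positivity
      side_succ_le := fun k => by
        rw [hδs]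
        gcongr
        exact hκ1 _
      two_le_branch := fun k => (hNM k _ (hδ k)).2.2.1
      branch_add_two_le := fun k => (hNM k _ (hδ k)).2.2.2.1
      mesh_mul_side_le := fun k => (hNM k _ (hδ k)).2.2.2.2.1
      growth := fun k => (hNM k _ (hδ k)).2.2.2.2.2 }
  have hdist : ∀ {k : ℕ} {x q : Fin n → ℝ}, x ∈ S.cube k q → dist x q ≤ δ k := by
    intro k x q hx
    refine (dist_pi_le_iff (hδ k).le).2 fun i => ?_
    have h1 : q i ≤ x i := hx.1 i
    have h2 : x i ≤ q i + δ k := hx.2 i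
    rw [Real.dist_eq, abs_of_nonneg] <;> linarith
  refine ⟨S.limitSet, S.isCompact_limitSet, S.dimH_limitSet, S.limitSet_subset, fun t N₀ => ?_⟩
  -- Stage `k` serves task `k.unpair.1`; pairing with `N₀` gives a stage for `t` that is at least
  -- `N₀`.
  set k := Nat.pair t N₀ with hk
  have hkt : k.unpair.1 = t := by rw [hk, Nat.unpair_pair]
  have hkN : N₀ ≤ k := Nat.right_le_pair t N₀
  refine ⟨N k (δ k), hkN.trans (hNM k _ (hδ k)).2.1, ?_, fun x hx => ?_⟩
  · have := (hNM k _ (hδ k)).1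
    omega
  obtain ⟨q, d, hq, hd⟩ := S.exists_child_of_mem hx k
  refine ⟨q, fun i => ⌊(N k (δ k) : ℝ) * q i⌋ + 1 + d i, (hdist hq).trans ?_, ?_⟩
  · refine (S.side_le_half_pow k).trans ?_
    rw [one_div_pow]
    apply one_div_le_one_div_of_le (by positivity)
    have h1 : N₀ + 1 ≤ 2 ^ k := (Nat.succ_le_succ hkN).trans k.lt_two_pow_self
    exact_mod_cast h1
  · have h1 := hdist hd
    rw [hδs, hkt] at h1
    convert h1 using 2
    funext i
    simp only [CantorScheme.child, S, hkt]
    push_cast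
    split_ifs <;> rfl

/-! ### Nearly discrete functions and avoidance of their zeros -/

/-- The lattice `(1 / N) ℤⁿ`. -/
def scaledLattice (n N : ℕ) : Set (Fin n → ℝ) :=
  Set.range fun (p : Fin n → ℤ) i => (p i : ℝ) / N

/-- On quadruples of points of `(1 / N) ℤⁿ` of norm at most `3`, the values of `f` are relatively
close to multiples of some `g` which is not much smaller than `1 / N ^ 8`. -/
def NearlyDiscrete {n : ℕ}
    (f : (Fin n → ℝ) × (Fin n → ℝ) × (Fin n → ℝ) × (Fin n → ℝ) → ℝ) : Prop :=
  ∀ ε > 0, ∃ κ > 0, ∀ N : ℕ, 0 < N → ∃ g : ℝ, κ / (N : ℝ) ^ 8 ≤ g ∧ g ≤ 1 / N ∧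
    ∀ P ∈ scaledLattice n N ×ˢ scaledLattice n N ×ˢ scaledLattice n N ×ˢ scaledLattice n N,
      ‖P‖ ≤ 3 → ∃ m : ℤ, |f P - m * g| ≤ ε * g

/-- A number that is obtained from a multiple of `g` by adding a quantity of moderate size is not
zero. -/
lemma ne_zero_of_abs_sub_mul_lt {a c g : ℝ} (m : ℤ) (hc : c ≤ g / 2)
    (h1 : c / 2 < |a - m * g|) (h2 : |a - m * g| ≤ 3 / 2 * c) : a ≠ 0 := by
  rintro rfl
  rw [zero_sub, abs_neg] at h1 h2
  rcases eq_or_ne m 0 with rfl | hm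
  · simp at h1 h2
    linarith
  · have hg : 0 < g := by linarith
    have hone : (1 : ℝ) ≤ |(m : ℝ)| := by exact_mod_cast Int.one_le_abs hm
    rw [abs_mul, abs_of_pos hg] at h2
    nlinarith

/-- Near a lattice point whose first component has been shifted by a suitable multiple of `e`, the
function `f` has no zeros, provided that the shift changes `f` at a linear rate. -/
lemma NearlyDiscrete.exists_shift_ne_zero {n : ℕ}
    {f : (Fin n → ℝ) × (Fin n → ℝ) × (Fin n → ℝ) × (Fin n → ℝ) → ℝ} (hf : NearlyDiscrete f)
    (hfd : ContDiff ℝ 1 f) {η : ℝ} (hη : 0 < η) :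
    ∃ κ > 0, κ ≤ 1 ∧ ∀ N : ℕ, ∃ τ : ℝ, 0 ≤ τ ∧ τ ≤ 1 / N ∧ (0 < N →
      ∀ P ∈ scaledLattice n N ×ˢ scaledLattice n N ×ˢ scaledLattice n N ×ˢ scaledLattice n N,
      ∀ e : Fin n → ℝ, ‖e‖ ≤ 1 → ∀ X, ‖X‖ ≤ 1 →
        dist X (P + τ • (e, 0, 0, 0)) ≤ κ / (N : ℝ) ^ 8 →
        τ * η ≤ |f (P + τ • (e, 0, 0, 0)) - f P| → f X ≠ 0) := by
  -- Radius `3` suffices: `X` has norm at most `1`, and the shifted and unshifted lattice points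
  -- each lie within a further `1`.
  obtain ⟨K, hK⟩ := hfd.contDiffOn.exists_lipschitzOnWith (s := Metric.closedBall 0 3)
    one_ne_zero (convex_closedBall _ _) (isCompact_closedBall _ _)
  set L : ℝ := K + 1 with hL
  have hL1 : 1 ≤ L := by rw [hL]; linarith [K.coe_nonneg]
  have hlip : ∀ A B, ‖A‖ ≤ 3 → ‖B‖ ≤ 3 → |f A - f B| ≤ L * dist A B := fun A B hA hB => by
    rw [← Real.dist_eq]
    refine (hK.dist_le_mul A (by simpa using hA) B (by simpa using hB)).trans ?_
    gcongr
    rw [hL]; linarith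
  -- With `τ = g / (2 * L)` this tolerance times `g` equals `τ * η / 8`. The discretisation error
  -- and the error from `X` both obey that bound, so together they are at most a quarter of the
  -- change caused by the shift.
  obtain ⟨κ, hκ, hdisc⟩ := hf (η / (16 * L)) (by positivity)
  refine ⟨min 1 (η * κ / (16 * L ^ 2)), by positivity, min_le_left _ _, fun N => ?_⟩
  rcases Nat.eq_zero_or_pos N with rfl | hN
  · exact ⟨0, le_rfl, by simp, fun h => absurd h (lt_irrefl _)⟩
  have hN' : (1 : ℝ) ≤ N := by exact_mod_cast hN
  obtain ⟨g, hg, hgN, hlat⟩ := hdisc N hN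
  have hg0 : 0 < g := lt_of_lt_of_le (by positivity) hg
  set τ := g / (2 * L) with hτ
  have hτ0 : 0 < τ := by positivity
  have hτg : τ ≤ g := div_le_self hg0.le (by linarith)
  have hN1 : 1 / (N : ℝ) ≤ 1 := (div_le_one (by positivity)).2 hN'
  refine ⟨τ, hτ0.le, hτg.trans hgN, fun _ P hP e he X hX hXP hlow => ?_⟩
  have hE : ‖τ • ((e, 0, 0, 0) : (Fin n → ℝ) × (Fin n → ℝ) × (Fin n → ℝ) × (Fin n → ℝ))‖ ≤ τ := by
    rw [norm_smul, Real.norm_of_nonneg hτ0.le]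
    refine mul_le_of_le_one_right hτ0.le ?_
    simpa [Prod.norm_def] using he
  set Q := P + τ • ((e, 0, 0, 0) : (Fin n → ℝ) × (Fin n → ℝ) × (Fin n → ℝ) × (Fin n → ℝ)) with hQ
  have hdQP : dist Q P ≤ τ := by rw [dist_eq_norm, hQ, add_sub_cancel_left]; exact hE
  have hXQ1 : dist X Q ≤ 1 := hXP.trans <|
    (div_le_self (by positivity) (one_le_pow₀ hN')).trans (min_le_left _ _)
  have hQn : ‖Q‖ ≤ 2 := by
    have := norm_le_norm_add_norm_sub' Q X
    rw [← dist_eq_norm, dist_comm] at this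
    linarith
  have hPn : ‖P‖ ≤ 3 := by
    have := norm_le_norm_add_norm_sub' P Q
    rw [← dist_eq_norm, dist_comm] at this
    linarith
  obtain ⟨m, hm⟩ := hlat P hP hPn
  have h1 := hlip X Q (by linarith) (by linarith)
  have h2 := hlip Q P (by linarith) hPn
  have h3 : L * dist X Q ≤ η / (16 * L) * g := by
    calc L * dist X Q ≤ L * (η * κ / (16 * L ^ 2) / (N : ℝ) ^ 8) := by
          gcongr
          exact hXP.trans (by gcongr; exact min_le_right _ _)
      _ = η / (16 * L) * (κ / (N : ℝ) ^ 8) := by field_simp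
      _ ≤ _ := by gcongr
  have h4 : L * dist Q P ≤ g / 2 := by
    calc L * dist Q P ≤ L * τ := by gcongr
      _ = g / 2 := by rw [hτ]; field_simp
  have h5 : η / (16 * L) * g = τ * η / 8 := by rw [hτ]; field_simp; norm_num
  have hτη : 0 < τ * η := by positivity
  rw [h5] at h3 hm
  set c := |f Q - f P| with hc
  have e1 := abs_sub_abs_le_abs_sub (f Q - f P) (f Q - f X - (f P - m * g))
  have e2 : |f X - m * g| ≤ |f Q - f P| + |f X - f Q| + |f P - m * g| := by
    calc |f X - m * g| = |(f Q - f P) + (f X - f Q) + (f P - m * g)| := by ring_nf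
      _ ≤ _ := abs_add_three _ _ _
  have e3 : |f Q - f P| ≤ |f X - m * g| + |f X - f Q| + |f P - m * g| := by
    calc |f Q - f P| = |(f X - m * g) + (f Q - f X) + (-(f P - m * g))| := by ring_nf
      _ ≤ _ := abs_add_three _ _ _
      _ = _ := by rw [abs_neg, abs_sub_comm (f Q)]
  refine ne_zero_of_abs_sub_mul_lt m (c := c) (g := g) ?_ ?_ ?_ <;> linarith

/-- Where the derivative in a direction `(h, 0, 0, 0)` does not vanish, shifting the first
component along some coordinate axis changes `f` at a linear rate. -/
lemma exists_eventually_le_abs_sub {n : ℕ}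
    {f : (Fin n → ℝ) × (Fin n → ℝ) × (Fin n → ℝ) × (Fin n → ℝ) → ℝ} (hfd : ContDiff ℝ 1 f)
    {X : (Fin n → ℝ) × (Fin n → ℝ) × (Fin n → ℝ) × (Fin n → ℝ)} {h : Fin n → ℝ}
    (hX : fderiv ℝ f X (h, 0, 0, 0) ≠ 0) :
    ∃ i : Fin n, ∀ᶠ m : ℕ in atTop, ∀ P, ∀ τ : ℝ, 0 ≤ τ →
      dist P X ≤ 1 / (m + 1) →
      dist (P + τ • ((Pi.single i 1, 0, 0, 0) :
        (Fin n → ℝ) × (Fin n → ℝ) × (Fin n → ℝ) × (Fin n → ℝ))) X ≤ 1 / (m + 1) →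
      τ * (1 / (m + 1)) ≤ |f (P + τ • (Pi.single i 1, 0, 0, 0)) - f P| := by
  obtain ⟨i, hi⟩ : ∃ i : Fin n, fderiv ℝ f X (Pi.single i 1, 0, 0, 0) ≠ 0 := by
    by_contra! H
    apply hX
    have h0 : (fderiv ℝ f X).toLinearMap ∘ₗ LinearMap.inl ℝ (Fin n → ℝ) _ = 0 := by
      refine LinearMap.pi_ext' fun i => LinearMap.ext_ring ?_
      exact H i
    exact LinearMap.congr_fun h0 h
  refine ⟨i, ?_⟩
  set v : (Fin n → ℝ) × (Fin n → ℝ) × (Fin n → ℝ) × (Fin n → ℝ) := (Pi.single i 1, 0, 0, 0)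
    with hv
  set D := fderiv ℝ f X v with hD
  have hD0 : 0 < |D| := abs_pos.2 hi
  have hvn : ‖v‖ ≤ 1 := by simp [hv, Prod.norm_def, Pi.norm_single]
  have hstrict : HasStrictFDerivAt f (fderiv ℝ f X) X :=
    hfd.contDiffAt.hasStrictFDerivAt one_ne_zero
  have hev := (hstrict.isLittleO.def (half_pos hD0))
  obtain ⟨r, hr, hball⟩ := Metric.eventually_nhds_iff.1 hev
  -- The same `1 / (m + 1)` serves as radius and as rate: it must be below `r` and below `|D| / 2`,
  -- the rate left by strict differentiability.
  have hlim := tendsto_one_div_add_atTop_nhds_zero_nat (𝕜 := ℝ)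
  filter_upwards [hlim.eventually (gt_mem_nhds hr), hlim.eventually (gt_mem_nhds (half_pos hD0))]
    with m hm1 hm2 P τ hτ hP hQ
  have h1 := hball (y := (P + τ • v, P)) (by
    rw [Prod.dist_eq]
    exact max_lt (hQ.trans_lt hm1) (hP.trans_lt hm1))
  simp only [add_sub_cancel_left, map_smul, norm_smul, Real.norm_eq_abs, abs_of_nonneg hτ,
    smul_eq_mul, ← hD] at h1
  have h2 : |D| / 2 * (τ * ‖v‖) ≤ |D| / 2 * τ := by
    gcongr
    exact mul_le_of_le_one_right hτ hvn
  have h3 : |τ * D| ≤ |f (P + τ • v) - f P| + |f (P + τ • v) - f P - τ * D| := by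
    calc |τ * D| = |(f (P + τ • v) - f P) - (f (P + τ • v) - f P - τ * D)| := by ring_nf
      _ ≤ _ := abs_sub _ _
  rw [abs_mul, abs_of_nonneg hτ] at h3
  have h4 : τ * (1 / (m + 1)) ≤ τ * (|D| / 2) := by gcongr
  linarith

/-- For countably many nearly discrete functions of four points there is a compact set of dimension
`n / 8` without configurations that are zeros at which the gradient with respect to the first
point does not vanish. -/
theorem exists_isCompact_dimH_eq_forall_ne_zero {n : ℕ} (hn : 0 < n) {ι : Type*} [Countable ι]
    [Nonempty ι] (f : ι → (Fin n → ℝ) × (Fin n → ℝ) × (Fin n → ℝ) × (Fin n → ℝ) → ℝ)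
    (hfd : ∀ l, ContDiff ℝ 1 (f l)) (hf : ∀ l, NearlyDiscrete (f l)) :
    ∃ E : Set (Fin n → ℝ), IsCompact E ∧ dimH E = (n : ℝ≥0∞) / 8 ∧
      ∀ l, ∀ x ∈ E, ∀ y ∈ E, ∀ z ∈ E, ∀ v ∈ E, x ≠ y → x ≠ z → x ≠ v →
        (∃ h : Fin n → ℝ, fderiv ℝ (f l) (x, y, z, v) (h, 0, 0, 0) ≠ 0) →
        f l (x, y, z, v) ≠ 0 := by
  classical
  have hηpos : ∀ m : ℕ, 0 < 1 / ((m : ℝ) + 1) := fun m => by positivity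
  have hshift := fun (l : ι) (m : ℕ) =>
    (hf l).exists_shift_ne_zero (hfd l) (hηpos m)
  choose κ hκ hκ1 τ hτ0 hτ1 hne using hshift
  have : Nonempty (Fin n) := ⟨⟨0, hn⟩⟩
  -- A task consists of a function, a shift axis, the index `m` of radius and rate, and the centre
  -- of the ball to be shifted.
  obtain ⟨task, htask⟩ := exists_surjective_nat (ι × Fin n × ℕ × ℕ)
  let c : ℕ → Fin n → ℝ := TopologicalSpace.denseSeq (Fin n → ℝ)
  obtain ⟨E, hEc, hEd, hE1, hE⟩ := exists_isCompact_near_lattice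
    (fun t => κ (task t).1 (task t).2.2.1) (fun t => hκ _ _) (fun t => hκ1 _ _)
    (fun t N => Pi.single (task t).2.1 (τ (task t).1 (task t).2.2.1 N))
    (fun t N i => by
      rcases eq_or_ne i (task t).2.1 with rfl | h
      · rw [Pi.single_eq_same]; exact hτ0 _ _ _
      · rw [Pi.single_eq_of_ne h])
    (fun t N i => by
      rcases eq_or_ne i (task t).2.1 with rfl | h
      · rw [Pi.single_eq_same]; exact hτ1 _ _ _
      · rw [Pi.single_eq_of_ne h]; positivity)
    (fun t => Metric.ball (c (task t).2.2.2) (1 / ((task t).2.2.1 + 1)))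
  refine ⟨E, hEc, hEd, fun l x hx y hy z hz v hv hxy hxz hxv hgrad => ?_⟩
  obtain ⟨h, hh⟩ := hgrad
  obtain ⟨i, hi⟩ := exists_eventually_le_abs_sub (hfd l) hh
  obtain ⟨ρ, hρ, hρy, hρz, hρv⟩ : ∃ ρ > 0, 3 * ρ ≤ dist x y ∧ 3 * ρ ≤ dist x z ∧
      3 * ρ ≤ dist x v := by
    refine ⟨min (dist x y) (min (dist x z) (dist x v)) / 3, ?_, ?_, ?_, ?_⟩
    · have := dist_pos.2 hxy
      have := dist_pos.2 hxz
      have := dist_pos.2 hxv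
      positivity
    · linarith [min_le_left (dist x y) (min (dist x z) (dist x v))]
    · linarith [min_le_right (dist x y) (min (dist x z) (dist x v)),
        min_le_left (dist x z) (dist x v)]
    · linarith [min_le_right (dist x y) (min (dist x z) (dist x v)),
        min_le_right (dist x z) (dist x v)]
  obtain ⟨m, hm, hmρ⟩ := (hi.and
    (tendsto_one_div_add_atTop_nhds_zero_nat.eventually (gt_mem_nhds hρ))).exists
  obtain ⟨j, hj⟩ : ∃ j, dist x (c j) < 1 / (m + 1) / 2 :=
    Metric.denseRange_iff.1 (TopologicalSpace.denseRange_denseSeq _) x _ (half_pos (hηpos m))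
  obtain ⟨t, ht⟩ := htask (l, i, m, j)
  -- The factor `2` makes the parent cubes smaller than half the radius of the ball, and the shift
  -- plus the lattice error at most `1 / (m + 1)`.
  obtain ⟨N, hN0, hN, hNE⟩ := hE t (2 * (m + 1))
  simp only [ht] at hNE
  have hN' : (0 : ℝ) < N := by exact_mod_cast hN
  have hη := hηpos m
  have hsmall : 1 / (((2 * (m + 1) : ℕ) : ℝ) + 1) < 1 / (m + 1) / 2 := by
    rw [div_div, mul_comm]
    apply one_div_lt_one_div_of_lt (by positivity)
    push_cast
    linarith
  have hNinv : 1 / (N : ℝ) ≤ 1 / (m + 1) / 2 := by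
    rw [div_div, mul_comm]
    apply one_div_le_one_div_of_le (by positivity)
    exact_mod_cast hN0
  have hfar : ∀ w ∈ E, 3 * ρ ≤ dist x w → ∃ p ∈ scaledLattice n N,
      dist w p ≤ κ l m / (N : ℝ) ^ 8 := by
    intro w hw hxw
    obtain ⟨q, p, hq, hp⟩ := hNE w hw
    -- Otherwise `w` would be within `2 / (m + 1) < 2 * ρ` of `x`.
    have hqU : q ∉ Metric.ball (c j) (1 / (m + 1)) := fun hqU => by
      rw [Metric.mem_ball] at hqU
      have := dist_triangle4 x (c j) q w
      rw [dist_comm (c j) q, dist_comm q w] at this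
      linarith
    simp only [if_neg hqU, add_zero] at hp
    exact ⟨_, ⟨p, rfl⟩, hp⟩
  obtain ⟨p₁, hp₁, hx₁⟩ : ∃ p ∈ scaledLattice n N,
      dist x (p + τ l m N • (Pi.single i 1 : Fin n → ℝ)) ≤ κ l m / (N : ℝ) ^ 8 := by
    obtain ⟨q, p, hq, hp⟩ := hNE x hx
    have hqU : q ∈ Metric.ball (c j) (1 / (m + 1)) := by
      rw [Metric.mem_ball]
      have := dist_triangle_left q (c j) x
      linarith
    refine ⟨_, ⟨p, rfl⟩, ?_⟩
    convert hp using 2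
    funext k
    simp only [if_pos hqU, Pi.add_apply, Pi.smul_apply, smul_eq_mul]
    rcases eq_or_ne k i with rfl | hk
    · simp
    · simp [hk]
  obtain ⟨p₂, hp₂, hy₂⟩ := hfar y hy hρy
  obtain ⟨p₃, hp₃, hz₃⟩ := hfar z hz hρz
  obtain ⟨p₄, hp₄, hv₄⟩ := hfar v hv hρv
  have hτN := hτ1 l m N
  have hτN0 := hτ0 l m N
  set T := τ l m N with hT
  have heq : (p₁, p₂, p₃, p₄) + T • ((Pi.single i 1, 0, 0, 0) :
      (Fin n → ℝ) × (Fin n → ℝ) × (Fin n → ℝ) × (Fin n → ℝ))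
      = (p₁ + T • (Pi.single i 1 : Fin n → ℝ), p₂, p₃, p₄) := by
    simp
  have hQ : dist (x, y, z, v) ((p₁, p₂, p₃, p₄) + T • ((Pi.single i 1, 0, 0, 0) :
      (Fin n → ℝ) × (Fin n → ℝ) × (Fin n → ℝ) × (Fin n → ℝ))) ≤ κ l m / (N : ℝ) ^ 8 := by
    rw [heq]
    simp only [Prod.dist_eq]
    exact max_le hx₁ (max_le hy₂ (max_le hz₃ hv₄))
  have hκN : κ l m / (N : ℝ) ^ 8 ≤ 1 / N := by
    have : (1 : ℝ) ≤ N := by exact_mod_cast hN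
    exact div_le_div₀ zero_le_one (hκ1 l m) hN' (le_self_pow₀ this (by norm_num))
  have hnorm : ∀ w ∈ E, ‖w‖ ≤ 1 := fun w hw => by
    refine (pi_norm_le_iff_of_nonneg zero_le_one).2 fun k => ?_
    have h0 : 0 ≤ w k := (hE1 hw).1 k
    have h1 : w k ≤ 1 := (hE1 hw).2 k
    rwa [Real.norm_of_nonneg h0]
  have hsingle : ‖(Pi.single i 1 : Fin n → ℝ)‖ ≤ 1 := by simp [Pi.norm_single]
  refine hne l m N hN (p₁, p₂, p₃, p₄) ⟨hp₁, hp₂, hp₃, hp₄⟩ (Pi.single i 1) hsingle _ ?_ hQ ?_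
  · simp only [Prod.norm_def]
    exact max_le (hnorm x hx) (max_le (hnorm y hy) (max_le (hnorm z hz) (hnorm v hv)))
  · refine hm _ _ hτN0 ?_ ?_
    · have h1 : dist ((p₁, p₂, p₃, p₄) + T • ((Pi.single i 1, 0, 0, 0) :
          (Fin n → ℝ) × (Fin n → ℝ) × (Fin n → ℝ) × (Fin n → ℝ))) (p₁, p₂, p₃, p₄) ≤ T := by
        rw [dist_eq_norm, add_sub_cancel_left, norm_smul, Real.norm_of_nonneg hτN0]
        refine mul_le_of_le_one_right hτN0 ?_
        simpa [Prod.norm_def] using hsingle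
      have := dist_triangle (p₁, p₂, p₃, p₄) ((p₁, p₂, p₃, p₄) + T • ((Pi.single i 1, 0, 0, 0) :
          (Fin n → ℝ) × (Fin n → ℝ) × (Fin n → ℝ) × (Fin n → ℝ))) (x, y, z, v)
      rw [dist_comm] at h1 hQ
      linarith
    · rw [dist_comm]
      linarith

/-! ### The forms attached to angles, their derivatives and near discreteness -/

/-- The inner product of `x - y` and `z - v`, as a function of `(x, y, z, v)`. -/
def dotForm {n : ℕ} (X : (Fin n → ℝ) × (Fin n → ℝ) × (Fin n → ℝ) × (Fin n → ℝ)) : ℝ :=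
  (X.1 - X.2.1) ⬝ᵥ (X.2.2.1 - X.2.2.2)

/-- A `2 × 2` minor of the matrix with columns `x - y` and `z - v`. -/
def minorForm {n : ℕ} (i j : Fin n)
    (X : (Fin n → ℝ) × (Fin n → ℝ) × (Fin n → ℝ) × (Fin n → ℝ)) : ℝ :=
  (X.1 i - X.2.1 i) * (X.2.2.1 j - X.2.2.2 j) - (X.1 j - X.2.1 j) * (X.2.2.1 i - X.2.2.2 i)

/-- The form vanishing where the angle between `x - y` and `z - v` has squared cosine `c`. -/
def angleForm {n : ℕ} (c : ℝ)
    (X : (Fin n → ℝ) × (Fin n → ℝ) × (Fin n → ℝ) × (Fin n → ℝ)) : ℝ :=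
  ((X.1 - X.2.1) ⬝ᵥ (X.2.2.1 - X.2.2.2)) ^ 2 -
    c * (((X.1 - X.2.1) ⬝ᵥ (X.1 - X.2.1)) *
      ((X.2.2.1 - X.2.2.2) ⬝ᵥ (X.2.2.1 - X.2.2.2)))

lemma contDiff_dotForm {n : ℕ} : ContDiff ℝ 1 (dotForm (n := n)) := by
  unfold dotForm dotProduct
  simp only [Pi.sub_apply]
  fun_prop

lemma contDiff_minorForm {n : ℕ} (i j : Fin n) : ContDiff ℝ 1 (minorForm i j) := by
  unfold minorForm
  fun_prop

lemma contDiff_angleForm {n : ℕ} (c : ℝ) : ContDiff ℝ 1 (angleForm (n := n) c) := by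
  unfold angleForm dotProduct
  simp only [Pi.sub_apply]
  fun_prop

/-- The directional derivative of a function which is quadratic along a line. -/
lemma fderiv_apply_eq_of_quadratic {F : Type*} [NormedAddCommGroup F] [NormedSpace ℝ F]
    {f : F → ℝ} {X u : F} (hf : DifferentiableAt ℝ f X) {b c : ℝ}
    (h : ∀ t : ℝ, f (X + t • u) = f X + t * b + t ^ 2 * c) : fderiv ℝ f X u = b := by
  rw [← hf.lineDeriv_eq_fderiv]
  refine HasLineDerivAt.lineDeriv ?_
  unfold HasLineDerivAt
  simp only [h]
  have := (((hasDerivAt_id (0 : ℝ)).mul_const b).const_add (f X)).add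
    (((hasDerivAt_id (0 : ℝ)).pow 2).mul_const c)
  convert this using 1
  · ext t
    simp
  · simp

lemma fderiv_dotForm {n : ℕ} (x y z v h : Fin n → ℝ) :
    fderiv ℝ dotForm (x, y, z, v) (h, 0, 0, 0) = h ⬝ᵥ (z - v) := by
  refine fderiv_apply_eq_of_quadratic (c := 0)
    (contDiff_dotForm.differentiable one_ne_zero _) fun t => ?_
  simp [dotForm, sub_dotProduct, add_dotProduct]
  ring

lemma fderiv_minorForm {n : ℕ} (i j : Fin n) (x y z v h : Fin n → ℝ) :
    fderiv ℝ (minorForm i j) (x, y, z, v) (h, 0, 0, 0)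
      = h i * (z j - v j) - h j * (z i - v i) := by
  refine fderiv_apply_eq_of_quadratic (c := 0)
    ((contDiff_minorForm i j).differentiable one_ne_zero _) fun t => ?_
  simp [minorForm]
  ring

/-- Along `z - v` the form is quadratic in the step, and its linear coefficient exhibits the
degenerate cases: `c = 1` and orthogonality. -/
lemma fderiv_angleForm {n : ℕ} (c : ℝ) (x y z v : Fin n → ℝ) :
    fderiv ℝ (angleForm c) (x, y, z, v) (z - v, 0, 0, 0)
      = 2 * (1 - c) * ((x - y) ⬝ᵥ (z - v)) * ((z - v) ⬝ᵥ (z - v)) := by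
  refine fderiv_apply_eq_of_quadratic
    (c := (1 - c) * ((z - v) ⬝ᵥ (z - v)) ^ 2)
    ((contDiff_angleForm c).differentiable one_ne_zero _) fun t => ?_
  have e : (x, y, z, v) + t • ((z - v, 0, 0, 0) :
      (Fin n → ℝ) × (Fin n → ℝ) × (Fin n → ℝ) × (Fin n → ℝ)) = (x + t • (z - v), y, z, v) := by
    simp
  rw [e]
  simp only [angleForm]
  have e2 : x + t • (z - v) - y = (x - y) + t • (z - v) := by abel
  rw [e2]
  generalize x - y = a
  generalize z - v = w
  simp only [add_dotProduct, dotProduct_add, smul_dotProduct, dotProduct_smul, smul_eq_mul,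
    dotProduct_comm w a]
  ring

lemma exists_dotProduct_eq_div {n N : ℕ} {x y z v : Fin n → ℝ} (hx : x ∈ scaledLattice n N)
    (hy : y ∈ scaledLattice n N) (hz : z ∈ scaledLattice n N) (hv : v ∈ scaledLattice n N) :
    ∃ m : ℤ, (x - y) ⬝ᵥ (z - v) = m / (N : ℝ) ^ 2 := by
  obtain ⟨p, rfl⟩ := hx
  obtain ⟨q, rfl⟩ := hy
  obtain ⟨r, rfl⟩ := hz
  obtain ⟨s, rfl⟩ := hv
  refine ⟨(p - q) ⬝ᵥ (r - s), ?_⟩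
  simp only [dotProduct, Pi.sub_apply]
  push_cast
  rw [Finset.sum_div]
  refine Finset.sum_congr rfl fun i _ => ?_
  rw [← sub_div, ← sub_div, div_mul_div_comm, sq]

lemma nearlyDiscrete_of_exists_eq_div {n : ℕ}
    {f : (Fin n → ℝ) × (Fin n → ℝ) × (Fin n → ℝ) × (Fin n → ℝ) → ℝ}
    (h : ∀ N : ℕ,
      ∀ P ∈ scaledLattice n N ×ˢ scaledLattice n N ×ˢ scaledLattice n N ×ˢ scaledLattice n N,
        ∃ m : ℤ, f P = m / (N : ℝ) ^ 2) : NearlyDiscrete f := by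
  refine fun ε hε => ⟨1, one_pos, fun N hN => ⟨1 / (N : ℝ) ^ 2, ?_, ?_, fun P hP _ => ?_⟩⟩
  · have : (1 : ℝ) ≤ N := by exact_mod_cast hN
    exact one_div_le_one_div_of_le (by positivity) (pow_le_pow_right₀ this (by norm_num))
  · have : (1 : ℝ) ≤ N := by exact_mod_cast hN
    exact one_div_le_one_div_of_le (by positivity) (le_self_pow₀ this (by norm_num))
  · obtain ⟨m, hm⟩ := h N P hP
    refine ⟨m, ?_⟩
    rw [hm, mul_one_div, sub_self, abs_zero]
    positivity

lemma nearlyDiscrete_dotForm {n : ℕ} : NearlyDiscrete (dotForm (n := n)) :=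
  nearlyDiscrete_of_exists_eq_div fun _ _ hP =>
    exists_dotProduct_eq_div hP.1 hP.2.1 hP.2.2.1 hP.2.2.2

lemma nearlyDiscrete_minorForm {n : ℕ} (i j : Fin n) : NearlyDiscrete (minorForm i j) := by
  refine nearlyDiscrete_of_exists_eq_div ?_
  rintro N ⟨_, _, _, _⟩ ⟨⟨p, rfl⟩, ⟨q, rfl⟩, ⟨r, rfl⟩, ⟨s, rfl⟩⟩
  refine ⟨(p i - q i) * (r j - s j) - (p j - q j) * (r i - s i), ?_⟩
  simp only [minorForm]
  push_cast
  ring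

lemma dotProduct_sub_self_le {n : ℕ} {x y : Fin n → ℝ} (hx : ‖x‖ ≤ 3) (hy : ‖y‖ ≤ 3) :
    (x - y) ⬝ᵥ (x - y) ≤ 36 * n := by
  have h : ∀ i, (x - y) i * (x - y) i ≤ 36 := fun i => by
    have h1 := (norm_le_pi_norm (x - y) i).trans (norm_sub_le x y)
    rw [Real.norm_eq_abs] at h1
    obtain ⟨h2, h3⟩ := abs_le.1 (h1.trans (by linarith : ‖x‖ + ‖y‖ ≤ 6))
    nlinarith
  calc (x - y) ⬝ᵥ (x - y) ≤ ∑ _i : Fin n, (36 : ℝ) := Finset.sum_le_sum fun i _ => h i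
    _ = 36 * n := by simp [mul_comm]

/-- Lattice values are `(A ^ 2 - c * B * C) / N ^ 4` with integers `A`, `B`, `C`. Replacing `c` by a
Dirichlet approximation `j / k` gives multiples of `1 / (N ^ 4 * k)`. As `|B * C|` is of order at
most `N ^ 4`, denominators up to `H * N ^ 4` are allowed in order to make the error small relative
to `g`, and this produces the exponent `8`. -/
lemma nearlyDiscrete_angleForm {n : ℕ} (c : ℝ) : NearlyDiscrete (angleForm (n := n) c) := by
  intro ε hε
  obtain ⟨H, hH⟩ := exists_nat_gt ((36 * n : ℝ) ^ 2 / ε)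
  have hH0 : (0 : ℝ) < H := lt_of_le_of_lt (by positivity) hH
  rw [div_lt_iff₀ hε] at hH
  refine ⟨1 / H, by positivity, fun N hN => ?_⟩
  have hN' : (1 : ℝ) ≤ N := by exact_mod_cast hN
  have hHN : 0 < H * N ^ 4 := by
    have : 0 < H := by exact_mod_cast hH0
    positivity
  obtain ⟨j, k, hk, hkH, hjk⟩ := Real.exists_int_int_abs_mul_sub_le c hHN
  have hk1 : (1 : ℝ) ≤ k := by exact_mod_cast hk
  have hkH' : (k : ℝ) ≤ H * (N : ℝ) ^ 4 := by exact_mod_cast hkH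
  refine ⟨1 / ((N : ℝ) ^ 4 * k), ?_, ?_, ?_⟩
  · rw [div_div]
    apply one_div_le_one_div_of_le (by positivity)
    calc (N : ℝ) ^ 4 * k ≤ (N : ℝ) ^ 4 * (H * (N : ℝ) ^ 4) := by gcongr
      _ = H * (N : ℝ) ^ 8 := by ring
  · apply one_div_le_one_div_of_le (by positivity)
    calc (N : ℝ) ≤ (N : ℝ) ^ 4 := le_self_pow₀ hN' (by norm_num)
      _ ≤ (N : ℝ) ^ 4 * k := le_mul_of_one_le_right (by positivity) hk1
  rintro ⟨x, y, z, v⟩ ⟨hx, hy, hz, hv⟩ hP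
  simp only [Prod.norm_def, sup_le_iff] at hP
  obtain ⟨A, hA⟩ := exists_dotProduct_eq_div hx hy hz hv
  obtain ⟨B, hB⟩ := exists_dotProduct_eq_div hx hy hx hy
  obtain ⟨C, hC⟩ := exists_dotProduct_eq_div hz hv hz hv
  have hBC : |(B * C : ℝ)| ≤ (36 * n) ^ 2 * (N : ℝ) ^ 4 := by
    have hB0 : 0 ≤ (x - y) ⬝ᵥ (x - y) := Finset.sum_nonneg fun i _ => mul_self_nonneg _
    have hC0 : 0 ≤ (z - v) ⬝ᵥ (z - v) := Finset.sum_nonneg fun i _ => mul_self_nonneg _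
    have hB1 := dotProduct_sub_self_le hP.1 hP.2.1
    have hC1 := dotProduct_sub_self_le hP.2.2.1 hP.2.2.2
    have e : (B * C : ℝ) = ((x - y) ⬝ᵥ (x - y)) * ((z - v) ⬝ᵥ (z - v)) * (N : ℝ) ^ 4 := by
      rw [hB, hC]; field_simp
    rw [e, abs_of_nonneg (by positivity), sq]
    gcongr
  refine ⟨A ^ 2 * k - j * (B * C), ?_⟩
  have e : angleForm c (x, y, z, v) -
      ((A ^ 2 * k - j * (B * C) : ℤ) : ℝ) * (1 / ((N : ℝ) ^ 4 * k))
      = -((B * C) * (k * c - j)) * (1 / ((N : ℝ) ^ 4 * k)) := by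
    simp only [angleForm]
    rw [hA, hB, hC]
    push_cast
    field_simp
    ring
  rw [e, abs_mul, abs_neg, abs_mul, abs_of_pos (by positivity : 0 < 1 / ((N : ℝ) ^ 4 * k))]
  gcongr
  calc |(B * C : ℝ)| * |k * c - j|
      ≤ (36 * n) ^ 2 * (N : ℝ) ^ 4 * (1 / ((H * N ^ 4 : ℕ) + 1)) := by gcongr
    _ ≤ H * ε * (N : ℝ) ^ 4 * (1 / (H * (N : ℝ) ^ 4)) := by
        push_cast
        gcongr
        linarith
    _ = ε := by field_simp

/-- Equality in the Cauchy-Schwarz inequality forces proportionality. -/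
lemma eq_smul_of_dotProduct_sq_eq {n : ℕ} {a w : Fin n → ℝ} (hw : w ⬝ᵥ w ≠ 0)
    (h : (a ⬝ᵥ w) ^ 2 = (a ⬝ᵥ a) * (w ⬝ᵥ w)) : ∃ r : ℝ, a = r • w := by
  refine ⟨a ⬝ᵥ w / w ⬝ᵥ w, sub_eq_zero.1 (dotProduct_self_eq_zero.1 ?_)⟩
  simp only [sub_dotProduct, dotProduct_sub, smul_dotProduct, dotProduct_smul, smul_eq_mul,
    dotProduct_comm w a]
  field_simp
  linarith

/-! ### Sets avoiding countably many angles -/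

theorem theorem3p4 (n : ℕ) (hn : 2 ≤ n) (S : Set ℝ) (hS : S ⊆ Set.Icc 0 Real.pi)
    (hSc : S.Countable) :
    ∃ E : Set (EuclideanSpace ℝ (Fin n)),
      IsCompact E ∧
      dimH E = (n : ℝ≥0∞) / 8 ∧
      (∀ x ∈ E, ∀ y ∈ E, ∀ z ∈ E, x ≠ y → x ≠ z → y ≠ z →
        EuclideanGeometry.angle x y z ∉ S) ∧
      (∀ x ∈ E, ∀ y ∈ E, ∀ z ∈ E, ∀ v ∈ E,
        x ≠ y → x ≠ z → x ≠ v → y ≠ z → y ≠ v → z ≠ v →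
        InnerProductGeometry.angle (x - y) (z - v) ∉ S) := by
  have : Countable S := hSc
  let form : Option ((Fin n × Fin n) ⊕ S) →
      (Fin n → ℝ) × (Fin n → ℝ) × (Fin n → ℝ) × (Fin n → ℝ) → ℝ
    | none => dotForm
    | some (.inl p) => minorForm p.1 p.2
    | some (.inr s) => angleForm (Real.cos s ^ 2)
  obtain ⟨E, hEc, hEd, hE⟩ := exists_isCompact_dimH_eq_forall_ne_zero (by omega : 0 < n) form
    (by
      rintro (_ | p | s)
      exacts [contDiff_dotForm, contDiff_minorForm _ _, contDiff_angleForm _])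
    (by
      rintro (_ | p | s)
      exacts [nearlyDiscrete_dotForm, nearlyDiscrete_minorForm _ _, nearlyDiscrete_angleForm _])
  let e := (PiLp.continuousLinearEquiv 2 ℝ (fun _ : Fin n => ℝ)).symm
  -- The point `y` may coincide with `z` or `v`, so that both kinds of angle are covered.
  have key : ∀ x ∈ E, ∀ y ∈ E, ∀ z ∈ E, ∀ v ∈ E, x ≠ y → x ≠ z → x ≠ v → z ≠ v →
      InnerProductGeometry.angle (e x - e y) (e z - e v) ∉ S := by
    intro x hx y hy z hz v hv hxy hxz hxv hzv hθ
    set θ := InnerProductGeometry.angle (e x - e y) (e z - e v) with hθdef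
    have hin : ∀ a b : Fin n → ℝ, inner ℝ (e a) (e b) = a ⬝ᵥ b := fun a b => by
      simp [e, PiLp.inner_apply, dotProduct, mul_comm]
    have hww : (z - v) ⬝ᵥ (z - v) ≠ 0 :=
      fun h => hzv (sub_eq_zero.1 (dotProduct_self_eq_zero.1 h))
    have hcos : ((x - y) ⬝ᵥ (z - v)) ^ 2
        = Real.cos θ ^ 2 * (((x - y) ⬝ᵥ (x - y)) * ((z - v) ⬝ᵥ (z - v))) := by
      rw [← hin, ← hin, ← hin, map_sub, map_sub, real_inner_self_eq_norm_sq,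
        real_inner_self_eq_norm_sq, ← InnerProductGeometry.cos_angle_mul_norm_mul_norm]
      ring
    by_cases hdot : (x - y) ⬝ᵥ (z - v) = 0
    · refine hE none x hx y hy z hz v hv hxy hxz hxv ⟨z - v, ?_⟩ hdot
      exact (fderiv_dotForm x y z v (z - v)).trans_ne hww
    by_cases hc : Real.cos θ ^ 2 = 1
    · rw [hc, one_mul] at hcos
      obtain ⟨r, hr⟩ := eq_smul_of_dotProduct_sq_eq hww hcos
      obtain ⟨i, hi⟩ := Function.ne_iff.1 hzv
      have : Nontrivial (Fin n) := Fin.nontrivial_iff_two_le.2 hn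
      -- Here `n ≥ 2` enters: a minor needs a second coordinate, and its derivative along axis `j`
      -- is `-(z i - v i) ≠ 0`.
      obtain ⟨j, hj⟩ := exists_ne i
      refine hE (some (.inl (i, j))) x hx y hy z hz v hv hxy hxz hxv ⟨Pi.single j 1, ?_⟩ ?_
      · refine (fderiv_minorForm i j x y z v _).trans_ne ?_
        rw [Pi.single_eq_of_ne hj.symm, Pi.single_eq_same]
        simpa [sub_eq_zero] using Ne.symm hi
      · have h1 := congrFun hr i
        have h2 := congrFun hr j
        simp only [Pi.sub_apply, Pi.smul_apply, smul_eq_mul] at h1 h2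
        simp only [form, minorForm]
        rw [h1, h2]
        ring
    · refine hE (some (.inr ⟨θ, hθ⟩)) x hx y hy z hz v hv hxy hxz hxv ⟨z - v, ?_⟩ ?_
      · refine (fderiv_angleForm _ x y z v).trans_ne ?_
        exact mul_ne_zero (mul_ne_zero (mul_ne_zero two_ne_zero
          (sub_ne_zero.2 (Ne.symm hc))) hdot) hww
      · exact sub_eq_zero.2 hcos
  refine ⟨e '' E, hEc.image e.continuous, (e.dimH_image E).trans hEd, ?_, ?_⟩
  · rintro _ ⟨x, hx, rfl⟩ _ ⟨y, hy, rfl⟩ _ ⟨z, hz, rfl⟩ hxy hxz hyz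
    exact key x hx y hy z hz y hy (ne_of_apply_ne e hxy) (ne_of_apply_ne e hxz)
      (ne_of_apply_ne e hxy) (ne_of_apply_ne e hyz.symm)
  · rintro _ ⟨x, hx, rfl⟩ _ ⟨y, hy, rfl⟩ _ ⟨z, hz, rfl⟩ _ ⟨v, hv, rfl⟩ hxy hxz hxv _ _ hzv
    exact key x hx y hy z hz v hv (ne_of_apply_ne e hxy) (ne_of_apply_ne e hxz)
      (ne_of_apply_ne e hxv) (ne_of_apply_ne e hzv)
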